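/- Let $G$ be a finite-dimensional real Lie group with Lie algebra $\mathfrak g=T_1G$, whose bracket $[\cdot,\cdot]_{\mathfrak g}$ is the one for which $V\mapsto(x\mapsto V\cdot x)$, $V\cdot x:=\frac{d}{dt}\big|_{t=0}\exp(tV)\,x\in T_xG$, is a Lie algebra morphism into the vector fields on $G$. For a smooth map $f\colon G\to\mathfrak g$ let $\lambda(f)$ be the vector field $\lambda(f)(x)=f(x)\cdot x$. Let $\mathfrak L=C^\infty(G,\mathfrak g)$ with the pointwise bracket $[f,g](x)=[f(x),g(x)]_{\mathfrak g}$ and the product $f\triangleright g=\lambda(f)(g)$ (the derivative of $g$ along $\lambda(f)$); this is a post-Lie algebra. It acts on the ring $C^\infty(G)$ of smooth scalar functions by $f\triangleright\phi=\lambda(f)(\phi)$. Let $U(\mathfrak L)$ be the universal enveloping algebra (over $\mathbb R$) of the Lie algebra $(\mathfrak L,[\cdot,\cdot])$, with the cocommutative coproduct $\Delta(A)=\sum A_{(1)}\otimes A_{(2)}$ for which the elements of $\mathfrak L$ are primitive. Extend $\triangleright$ to $U(\mathfrak L)\times U(\mathfrak L)\to U(\mathfrak L)$ and to $U(\mathfrak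 L)\times C^\infty(G)\to C^\infty(G)$ by $$1\triangleright B=B,\qquad fA\triangleright B=f\triangleright(A\triangleright B)-(f\triangleright A)\triangleright B,\qquad A\triangleright(BC)=\sum (A_{(1)}\triangleright B)(A_{(2)}\triangleright C)$$ for $f\in\mathfrak L$, $A\in U(\mathfrak L)$, and $B,C$ both in $U(\mathfrak L)$ or both in $C^\infty(G)$. Put $A*B=\sum A_{(1)}(A_{(2)}\triangleright B)$ on $U(\mathfrak L)$, and let $$\exp^*(tf)=\sum_{n\ge 0}\frac{t^n}{n!}\,f^{*n},\qquad f^{*0}=1,\quad f^{*(n+1)}=f*f^{*n},$$ a formal power series in $t$ with coefficients in $U(\mathfrak L)$, acting on $\phi\in C^\infty(G)$ coefficient by coefficient. For $f\in\mathfrak L$ let $\psi_{tf}$ denote the (local) time-$t$ flow of $\lambda(f)$: $\psi_{tf}(x)$ is the value at time $t$ of the maximal integral curve of $\lambda(f)$ which starts at $x$. Let $(\psi_{tf}^{\leftarrow}\phi)(x)=\phi(\psi_{tf}(x))$ be the pullback of $\phi\in C^\infty(G)$. Then, for all $f\in\mathfrak L$ and $\phi\in C^\infty(G)$, $$\psi_{tf}^{\leftarrow}\phi=\exp^*(tf)\triangleright\phi$$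 as a Taylor series in $t$: for every $x\in G$ the function $t\mapsto\phi(\psi_{tf}(x))$, which is defined for $t$ near $0$, is smooth at $t=0$, and for every $n\ge 0$ $$\frac{1}{n!}\,\frac{d^n}{dt^n}\Big|_{t=0}\phi(\psi_{tf}(x))=\frac{1}{n!}\,\bigl(f^{*n}\triangleright\phi\bigr)(x).$$ -/

import Mathlib

open scoped TensorProduct Manifold ContDiff

/-- A post-Lie algebra over `k`: a Lie algebra with a bilinear product `x ▷ y = prod x y` such that
`x ▷ [y, z] = [x ▷ y, z] + [y, x ▷ z]` and `[x, y] ▷ z = a(x, y, z) - a(y, x, z)`, where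
`a(x, y, z) = x ▷ (y ▷ z) - (x ▷ y) ▷ z`. -/
class PostLieAlgebra (k L : Type*) [CommRing k] [LieRing L] [LieAlgebra k L] where
  prod : L →ₗ[k] L →ₗ[k] L
  prod_lie : ∀ x y z : L, prod x ⁅y, z⁆ = ⁅prod x y, z⁆ + ⁅y, prod x z⁆
  lie_prod : ∀ x y z : L, prod ⁅x, y⁆ z =
    (prod x (prod y z) - prod (prod x y) z) - (prod y (prod x z) - prod (prod y x) z)

set_option linter.unusedSectionVars false

namespace PostLie

noncomputable section

section Algebra

attribute [local instance] LieRing.ofAssociativeRing LieAlgebra.ofAssociativeAlgebra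

variable (k : Type*) [CommRing k]

section Hopf

variable (L : Type*) [LieRing L] [LieAlgebra k L]

/-- The universal enveloping algebra. -/
abbrev U := UniversalEnvelopingAlgebra k L

/-- The inclusion of the Lie algebra. -/
abbrev ι (x : L) : U k L := UniversalEnvelopingAlgebra.ι k x

/-- The coshuffle coproduct `Δ`: the algebra morphism with `Δ x = x ⊗ 1 + 1 ⊗ x` on `L`. -/
def comul : U k L →ₐ[k] U k L ⊗[k] U k L :=
  UniversalEnvelopingAlgebra.lift k
    { toFun := fun x => ι k L x ⊗ₜ 1 + 1 ⊗ₜ ι k L x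
      map_add' := fun x y => by simp [TensorProduct.add_tmul, TensorProduct.tmul_add]; abel
      map_smul' := fun c x => by simp [TensorProduct.smul_tmul']
      map_lie' := fun {x y} => by
        simp only [LieHom.map_lie, LieRing.of_associative_ring_bracket, mul_add, add_mul,
          Algebra.TensorProduct.tmul_mul_tmul, one_mul, mul_one, TensorProduct.sub_tmul,
          TensorProduct.tmul_sub]
        abel }

/-- The counit `ε`. -/
def counit : U k L →ₐ[k] k := UniversalEnvelopingAlgebra.lift k 0

variable {L}

@[simp] lemma comul_ι (x : L) : comul k L (ι k L x) = ι k L x ⊗ₜ 1 + 1 ⊗ₜ ι k L x := by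
  simp only [comul, ι, UniversalEnvelopingAlgebra.lift_ι_apply]; rfl

@[simp] lemma counit_ι (x : L) : counit k L (ι k L x) = 0 := by
  simp only [counit, ι, UniversalEnvelopingAlgebra.lift_ι_apply]; rfl

variable {k}

/-- Every element of `U k L` is a linear combination of words `x₁ ⋯ xₙ`, built from the left. -/
lemma induct_left {p : U k L → Prop} (h1 : p 1) (hadd : ∀ A B, p A → p B → p (A + B))
    (hsmul : ∀ (c : k) A, p A → p (c • A)) (hmul : ∀ x A, p A → p (ι k L x * A)) (A : U k L) :
    p A := by
  let S : Submodule k (U k L) :=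
    { carrier := {A | p A}
      add_mem' := fun {a b} ha hb => hadd a b ha hb
      zero_mem' := by simpa using hsmul 0 1 h1
      smul_mem' := fun c a ha => hsmul c a ha }
  let T : Subalgebra k (U k L) :=
    { carrier := {A | ∀ B ∈ S, A * B ∈ S}
      mul_mem' := fun {a b} ha hb B hB => by rw [mul_assoc]; exact ha _ (hb _ hB)
      add_mem' := fun {a b} ha hb B hB => by rw [add_mul]; exact S.add_mem (ha _ hB) (hb _ hB)
      algebraMap_mem' := fun c B hB => by
        rw [← Algebra.smul_def]; exact S.smul_mem c hB }
  let g : L →ₗ⁅k⁆ T :=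
    { toFun := fun x => ⟨ι k L x, fun B hB => hmul x B hB⟩
      map_add' := fun x y => by ext; simp
      map_smul' := fun c x => by ext; simp
      map_lie' := fun {x y} => by
        ext; simp [LieRing.of_associative_ring_bracket] }
  have : T.val.comp (UniversalEnvelopingAlgebra.lift k g) = AlgHom.id k _ := by
    ext x
    simp only [LieHom.coe_comp, Function.comp_apply, AlgHom.coe_toLieHom, AlgHom.comp_apply,
      UniversalEnvelopingAlgebra.lift_ι_apply]
    rfl
  have hA : A ∈ T := by
    have h := congrArg (fun φ => φ A) this
    have h2 : ((UniversalEnvelopingAlgebra.lift k g A : T) : U k L) = A := h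
    rw [← h2]; exact (UniversalEnvelopingAlgebra.lift k g A).2
  have h3 := hA 1 h1
  rw [mul_one] at h3
  exact h3

/-- The same with words built from the right. -/
lemma induct_right {p : U k L → Prop} (h1 : p 1) (hadd : ∀ A B, p A → p B → p (A + B))
    (hsmul : ∀ (c : k) A, p A → p (c • A)) (hmul : ∀ x A, p A → p (A * ι k L x)) (A : U k L) :
    p A := by
  have key : ∀ A B : U k L, p B → p (B * A) := by
    intro A
    induction A using induct_left with
    | h1 => intro B hB; simpa using hB
    | hadd A A' h h' => intro B hB; rw [mul_add]; exact hadd _ _ (h B hB) (h' B hB)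
    | hsmul c A h => intro B hB; rw [mul_smul_comm]; exact hsmul _ _ (h B hB)
    | hmul x A h => intro B hB; rw [← mul_assoc]; exact h _ (hmul _ _ hB)
  simpa using key A 1 h1

end Hopf

section Extension

variable (L : Type*) [LieRing L] [LieAlgebra k L] [PostLieAlgebra k L]

/-- The post-Lie product `x ▷ y` of `L`. -/
abbrev tr : L →ₗ[k] L →ₗ[k] L := PostLieAlgebra.prod

variable {L}
lemma tr_lie (x y z : L) : tr k L x ⁅y, z⁆ = ⁅tr k L x y, z⁆ + ⁅y, tr k L x z⁆ :=
  PostLieAlgebra.prod_lie x y z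

lemma lie_tr (x y z : L) : tr k L ⁅x, y⁆ z =
    (tr k L x (tr k L y z) - tr k L (tr k L x y) z)
      - (tr k L y (tr k L x z) - tr k L (tr k L y x) z) :=
  PostLieAlgebra.lie_prod x y z

variable (L)

/-- The vector space `L` with the Lie bracket `⟦x, y⟧ = x ▷ y - y ▷ x + [x, y]`. -/
def Adj (k L : Type*) [CommRing k] [LieRing L] [LieAlgebra k L] [PostLieAlgebra k L] := L

instance : AddCommGroup (Adj k L) := inferInstanceAs (AddCommGroup L)
instance : Module k (Adj k L) := inferInstanceAs (Module k L)

variable {L}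

/-- The bracket `⟦x, y⟧ = x ▷ y - y ▷ x + [x, y]`. -/
def dbl (x y : L) : L := tr k L x y - tr k L y x + ⁅x, y⁆

variable {k} in
lemma tr_dbl (x y z : L) : tr k L (dbl k x y) z = tr k L x (tr k L y z) - tr k L y (tr k L x z) := by
  simp only [dbl, map_add, map_sub, LinearMap.add_apply, LinearMap.sub_apply, lie_tr]; abel

variable (L)

variable {L}

lemma dbl_add_left (x y z : L) : dbl k (x + y) z = dbl k x z + dbl k y z := by
  simp only [dbl, map_add, LinearMap.add_apply, add_lie]; abel

lemma dbl_add_right (x y z : L) : dbl k x (y + z) = dbl k x y + dbl k x z := by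
  simp only [dbl, map_add, LinearMap.add_apply, lie_add]; abel

lemma dbl_self (x : L) : dbl k x x = 0 := by simp [dbl]

lemma dbl_smul_right (c : k) (x y : L) : dbl k x (c • y) = c • dbl k x y := by
  simp [dbl, smul_sub, smul_add]

lemma dbl_jacobi (x y z : L) :
    dbl k x (dbl k y z) = dbl k (dbl k x y) z + dbl k y (dbl k x z) := by
  have h : ∀ a b : L, dbl k a b = tr k L a b - tr k L b a + ⁅a, b⁆ := fun _ _ => rfl
  rw [h x, h (dbl k x y), h y (dbl k x z), tr_dbl, tr_dbl, tr_dbl]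
  have j := leibniz_lie x y z
  simp only [dbl, map_add, map_sub, tr_lie,
    add_lie, lie_add, sub_lie, lie_sub, j]
  rw [← lie_skew (tr k L z x) y, ← lie_skew (tr k L y x) z]
  abel

variable (L)

instance : LieRing (Adj k L) where
  bracket x y := dbl (L := L) k x y
  add_lie x y z := dbl_add_left (L := L) k x y z
  lie_add x y z := dbl_add_right (L := L) k x y z
  lie_self x := dbl_self (L := L) k x
  leibniz_lie x y z := dbl_jacobi (L := L) k x y z

instance : LieAlgebra k (Adj k L) where
  lie_smul c x y := dbl_smul_right (L := L) k c x y

variable {k L}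
variable {V : Type*} [AddCommGroup V] [Module k V]

/-- The tautological map from `L` to `Adj k L`. -/
def toAdj : L ≃ₗ[k] Adj k L := LinearEquiv.refl k L

lemma lie_toAdj (x y : L) : ⁅toAdj (k := k) x, toAdj (k := k) y⁆ = toAdj (dbl k x y) := rfl

variable (k L) in
/-- `x ↦ x ▷ ·` is a representation of `Adj k L` on `L`. -/
def trRep : Adj k L →ₗ⁅k⁆ Module.End k L :=
  { toFun := fun x => tr k L (toAdj.symm x)
    map_add' := fun x y => by simp
    map_smul' := fun c x => by simp
    map_lie' := fun {x y} => by
      ext z; exact tr_dbl (k := k) (L := L) x y z }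

lemma trRep_toAdj (x : L) : trRep k L (toAdj x) = tr k L x := rfl

section Extend

variable (D : Adj k L →ₗ⁅k⁆ Module.End k V)

/-- For `p : U(Adj L) → V`, the bilinear map `(z, C) ↦ z · p(C) - p(z C)`. -/
def coindAux (p : U k (Adj k L) →ₗ[k] V) : L →ₗ[k] U k (Adj k L) →ₗ[k] V :=
  LinearMap.mk₂ k (fun z C => D (toAdj z) (p C) - p (ι k _ (toAdj z) * C))
    (fun _ _ _ => by simp [add_mul]; abel) (fun _ _ _ => by simp [smul_sub])
    (fun _ _ _ => by simp [mul_add]; abel) (fun _ _ _ => by simp [smul_sub])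

/-- The operator `p ↦ (C ↦ ∑ (C₁ ▷ x) · p(C₂) - p((C₁ ▷ x) C₂))` on `Hom(U(Adj L), V)`. -/
def coindFun (x : L) (p : U k (Adj k L) →ₗ[k] V) : U k (Adj k L) →ₗ[k] V :=
  TensorProduct.lift ((coindAux D p).comp
    ((UniversalEnvelopingAlgebra.lift k (trRep k L)).toLinearMap.flip x)) ∘ₗ
    (comul k (Adj k L)).toLinearMap

/-- Right translation of `p` by `z`. -/
def rtrans (z : L) : Module.End k (U k (Adj k L) →ₗ[k] V) :=
  LinearMap.lcomp k V (LinearMap.mulRight k (ι k (Adj k L) (toAdj z)))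

lemma rtrans_apply (z : L) (p : U k (Adj k L) →ₗ[k] V) (C) :
    rtrans z p C = p (C * ι k (Adj k L) (toAdj z)) := rfl

lemma coindFun_one (x : L) (p : U k (Adj k L) →ₗ[k] V) :
    coindFun D x p 1 = D (toAdj x) (p 1) - rtrans x p 1 := by
  simp [coindFun, coindAux, rtrans_apply, Algebra.TensorProduct.one_def]

lemma coindFun_mul (x z : L) (p : U k (Adj k L) →ₗ[k] V) (C) :
    coindFun D x p (C * ι k _ (toAdj z)) =
      coindFun D (tr k L z x) p C + coindFun D x (rtrans z p) C := by
  simp only [coindFun, LinearMap.comp_apply, AlgHom.toLinearMap_apply, map_mul, comul_ι]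
  induction comul k (Adj k L) C using TensorProduct.induction_on with
  | zero => simp
  | add a b ha hb => simp only [add_mul, map_add, ha, hb]; abel
  | tmul a b =>
    simp only [mul_add, Algebra.TensorProduct.tmul_mul_tmul, mul_one, map_add,
      TensorProduct.lift.tmul, LinearMap.comp_apply, LinearMap.flip_apply,
      AlgHom.toLinearMap_apply, map_mul, Module.End.mul_apply,
      UniversalEnvelopingAlgebra.lift_ι_apply, coindAux, LinearMap.mk₂_apply, rtrans_apply, mul_assoc]
    rfl

lemma coindFun_apply (x : L) (p : U k (Adj k L) →ₗ[k] V) (C) :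
    coindFun D x p C = TensorProduct.lift ((coindAux D p).comp
      ((UniversalEnvelopingAlgebra.lift k (trRep k L)).toLinearMap.flip x))
        (comul k (Adj k L) C) := rfl

/-- `coindFun` as a bilinear map. -/
def coind : L →ₗ[k] Module.End k (U k (Adj k L) →ₗ[k] V) :=
  LinearMap.mk₂ k (coindFun D)
    (fun x y p => by
      ext C; simp only [LinearMap.add_apply, coindFun_apply]
      induction comul k (Adj k L) C using TensorProduct.induction_on with
      | zero => simp
      | add a b ha hb => simp only [map_add] at ha hb ⊢; rw [ha, hb]; abel
      | tmul a b => simp)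
    (fun c x p => by
      ext C; simp only [LinearMap.smul_apply, coindFun_apply]
      induction comul k (Adj k L) C using TensorProduct.induction_on with
      | zero => simp
      | add a b ha hb => simp only [map_add, ha, hb, smul_add]
      | tmul a b => simp)
    (fun x p q => by
      ext C; simp only [LinearMap.add_apply, coindFun_apply]
      induction comul k (Adj k L) C using TensorProduct.induction_on with
      | zero => simp
      | add a b ha hb => simp only [map_add, ha, hb]; abel
      | tmul a b => simp [coindAux]; abel)
    (fun c x p => by
      ext C; simp only [LinearMap.smul_apply, coindFun_apply]
      induction comul k (Adj k L) C using TensorProduct.induction_on with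
      | zero => simp
      | add a b ha hb => simp only [map_add, ha, hb, smul_add]
      | tmul a b => simp [coindAux, smul_sub])

lemma coind_one (x : L) (p : U k (Adj k L) →ₗ[k] V) :
    coind D x p 1 = D (toAdj x) (p 1) - p (ι k _ (toAdj x)) := by
  have := coindFun_one D x p
  rwa [rtrans_apply, one_mul] at this

lemma coind_mul (x z : L) (p : U k (Adj k L) →ₗ[k] V) (C) :
    coind D x p (C * ι k _ (toAdj z)) =
      coind D (tr k L z x) p C + coind D x (rtrans z p) C := coindFun_mul D x z p C

lemma rtrans_coind (x z : L) (p : U k (Adj k L) →ₗ[k] V) :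
    rtrans z (coind D x p) = coind D (tr k L z x) p + coind D x (rtrans z p) := by
  ext C; exact coind_mul D x z p C

lemma rep_dbl (x y : L) (v : V) : D (toAdj x) (D (toAdj y) v) - D (toAdj y) (D (toAdj x) v) =
    D (toAdj (tr k L x y)) v - D (toAdj (tr k L y x)) v + D (toAdj ⁅x, y⁆) v := by
  have h := D.map_lie (toAdj x) (toAdj y)
  rw [lie_toAdj, dbl, map_add, map_sub, map_add, map_sub] at h
  have h2 := congrArg (fun φ : Module.End k V => φ v) h
  simp only [LinearMap.add_apply, LinearMap.sub_apply] at h2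
  rw [h2]; rfl

lemma ι_dbl (x y : L) : ι k (Adj k L) (toAdj x) * ι k _ (toAdj y) =
    ι k _ (toAdj y) * ι k _ (toAdj x) + ι k _ (toAdj (tr k L x y)) - ι k _ (toAdj (tr k L y x))
      + ι k _ (toAdj ⁅x, y⁆) := by
  have h := LieHom.map_lie (UniversalEnvelopingAlgebra.ι k : Adj k L →ₗ⁅k⁆ _)
    (toAdj x) (toAdj y)
  rw [lie_toAdj, dbl, map_add, map_sub, map_add, map_sub,
    LieRing.of_associative_ring_bracket] at h
  have h2 := sub_eq_iff_eq_add.1 h.symm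
  rw [h2]; simp only [ι]; abel

lemma coind_lie (x y : L) (p : U k (Adj k L) →ₗ[k] V) :
    coind D ⁅x, y⁆ p = coind D x (coind D y p) - coind D y (coind D x p) := by
  ext C
  induction C using induct_right generalizing x y p with
  | h1 =>
    have e : ∀ z w (q : U k (Adj k L) →ₗ[k] V), coind D z q (ι k _ (toAdj w)) =
        coind D (tr k L w z) q 1 + coind D z (rtrans w q) 1 := by
      intro z w q; have := coind_mul D z w q 1; rwa [one_mul] at this
    simp only [LinearMap.sub_apply, coind_one, e, map_sub, rtrans_apply]
    have h1 := rep_dbl D x y (p 1)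
    have h2 := congrArg p (ι_dbl (k := k) x y)
    simp only [map_add, map_sub] at h2
    rw [h2, sub_eq_iff_eq_add.1 h1]
    simp only [one_mul]
    abel
  | hadd A B hA hB => simp only [map_add, hA, hB]
  | hsmul c A h => simp only [map_smul, h]
  | hmul z C h =>
    obtain ⟨z, rfl⟩ := (toAdj (k := k) (L := L)).surjective z
    simp only [LinearMap.sub_apply, coind_mul, tr_lie, map_add, LinearMap.add_apply, h,
      rtrans_coind]
    abel

/-- `coind` as a representation of the Lie algebra `L`, extended to `U(L)`. -/
def coindAlg : U k L →ₐ[k] Module.End k (U k (Adj k L) →ₗ[k] V) :=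
  UniversalEnvelopingAlgebra.lift k
    { coind D with
      map_lie' := fun {x y} => by
        apply LinearMap.ext; intro p; exact coind_lie D x y p }

lemma coindAlg_ι (x : L) : coindAlg D (ι k L x) = coind D x := by
  simp only [coindAlg, ι, UniversalEnvelopingAlgebra.lift_ι_apply]; rfl

/-- The map `v ↦ ε(·) v`. -/
def constMap : V →ₗ[k] U k (Adj k L) →ₗ[k] V :=
  (LinearMap.lsmul k V).comp (counit k (Adj k L)).toLinearMap |>.flip

lemma constMap_apply (v : V) (C : U k (Adj k L)) :
    constMap v C = counit k (Adj k L) C • v := rfl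

/-- The extension `A ↦ A ▷ ·` to `A ∈ U(L)` of a representation `D` of `Adj k L` on `V`, characterized
by `1 ▷ v = v` and `xA ▷ v = x ▷ (A ▷ v) - (x ▷ A) ▷ v` for `x ∈ L`, `A ∈ U(L)`. -/
def extend : U k L →ₗ[k] V →ₗ[k] V :=
  ((LinearMap.applyₗ (1 : U k (Adj k L))).compRight k).comp
    (((LinearMap.lcomp k (U k (Adj k L) →ₗ[k] V) (constMap (k := k) (L := L) (V := V)))).comp (coindAlg D).toLinearMap)

lemma extend_apply (A : U k L) (v : V) : extend D A v = coindAlg D A (constMap v) 1 := rfl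

end Extend

/-- The action `A ↦ x ▷ A` of `x ∈ L` on `U(L)` by the derivation extending `y ↦ x ▷ y`, with the
values of `A` and `x ▷ A` packed together as a dual number. -/
def derivAux (x : L) : U k L →ₐ[k] DualNumber (U k L) :=
  UniversalEnvelopingAlgebra.lift k
    { toFun := fun y => (TrivSqZeroExt.inl (ι k L y) + TrivSqZeroExt.inr (ι k L (tr k L x y)) : DualNumber (U k L))
      map_add' := fun y z => by ext <;> simp
      map_smul' := fun c y => by ext <;> simp
      map_lie' := fun {y z} => by
        ext
        · simp [LieRing.of_associative_ring_bracket]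
        · simp [LieRing.of_associative_ring_bracket, tr_lie, -UniversalEnvelopingAlgebra.ι_apply]; abel }

/-- The derivation of `U(L)` extending `y ↦ x ▷ y`. -/
def uDeriv (x : L) : Module.End k (U k L) :=
  (TrivSqZeroExt.sndHom (U k L) (U k L)).restrictScalars k ∘ₗ (derivAux x).toLinearMap


lemma derivAux_fst (x : L) (A : U k L) : (derivAux (k := k) x A).fst = A := by
  have : (TrivSqZeroExt.fstHom k (U k L) (U k L)).comp (derivAux x) = AlgHom.id k _ := by
    ext y
    simp only [LieHom.coe_comp, Function.comp_apply, AlgHom.coe_toLieHom, AlgHom.comp_apply,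
      derivAux, UniversalEnvelopingAlgebra.lift_ι_apply]
    simp
  exact congrArg (fun φ => φ A) this

lemma uDeriv_apply (x : L) (A : U k L) : uDeriv x A = (derivAux (k := k) x A).snd := rfl

lemma uDeriv_one (x : L) : uDeriv x (1 : U k L) = 0 := by simp [uDeriv_apply]

lemma uDeriv_ι (x y : L) : uDeriv x (ι k L y) = ι k L (tr k L x y) := by
  simp only [uDeriv_apply, derivAux, ι, UniversalEnvelopingAlgebra.lift_ι_apply]
  simp

lemma uDeriv_mul (x : L) (A B : U k L) : uDeriv x (A * B) = uDeriv x A * B + A * uDeriv x B := by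
  simp [uDeriv_apply, derivAux_fst, add_comm]

lemma uDeriv_add_left (x y : L) (A : U k L) : uDeriv (x + y) A = uDeriv x A + uDeriv y A := by
  induction A using induct_left with
  | h1 => simp [uDeriv_one]
  | hadd A B hA hB => simp only [map_add, hA, hB]; abel
  | hsmul c A h => simp only [map_smul, h, smul_add]
  | hmul z A h =>
    simp only [uDeriv_mul, h, uDeriv_ι, map_add, LinearMap.add_apply, add_mul, mul_add]
    abel

lemma uDeriv_smul_left (c : k) (x : L) (A : U k L) : uDeriv (c • x) A = c • uDeriv x A := by
  induction A using induct_left with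
  | h1 => simp [uDeriv_one]
  | hadd A B hA hB => simp only [map_add, hA, hB, smul_add]
  | hsmul c A h => simp only [map_smul, h, smul_comm c]
  | hmul z A h =>
    simp only [uDeriv_mul, h, uDeriv_ι, map_smul, LinearMap.smul_apply, smul_add,
      smul_mul_assoc, mul_smul_comm]

variable (k L) in
/-- `x ↦ (A ↦ x ▷ A)` is a representation of `Adj k L` on `U(L)`. -/
def derivRep : Adj k L →ₗ⁅k⁆ Module.End k (U k L) :=
  { toFun := fun x => uDeriv (toAdj.symm x)
    map_add' := fun x y => by ext A; exact uDeriv_add_left (L := L) x y A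
    map_smul' := fun c x => by ext A; exact uDeriv_smul_left (L := L) c x A
    map_lie' := fun {x y} => by
      ext A
      induction A using induct_left with
      | h1 => simp [uDeriv_one, LieRing.of_associative_ring_bracket]
      | hadd A B hA hB => simp only [map_add, hA, hB]
      | hsmul c A h => simp only [map_smul, h]
      | hmul z A h =>
        obtain ⟨x, rfl⟩ := (toAdj (k := k) (L := L)).surjective x
        obtain ⟨y, rfl⟩ := (toAdj (k := k) (L := L)).surjective y
        simp only [lie_toAdj, LinearEquiv.symm_apply_apply, LieRing.of_associative_ring_bracket,
          LinearMap.sub_apply, Module.End.mul_apply] at h ⊢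
        simp only [uDeriv_mul, h, uDeriv_ι, map_add, tr_dbl, map_sub, sub_mul, mul_sub]
        abel }

lemma derivRep_toAdj (x : L) : derivRep k L (toAdj x) = uDeriv x := rfl

section Extend

variable (D : Adj k L →ₗ⁅k⁆ Module.End k V)

lemma rtrans_coindAlg (z : L) (A : U k L) (p : U k (Adj k L) →ₗ[k] V) :
    rtrans z (coindAlg D A p) = coindAlg D (uDeriv z A) p + coindAlg D A (rtrans z p) := by
  induction A using induct_left generalizing p with
  | h1 => simp [uDeriv_one]
  | hadd A B hA hB => simp only [map_add, LinearMap.add_apply, hA, hB]; abel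
  | hsmul c A h => simp only [map_smul, LinearMap.smul_apply, h, smul_add]
  | hmul x A h =>
    simp only [map_mul, Module.End.mul_apply, coindAlg_ι, rtrans_coind, h, uDeriv_mul, uDeriv_ι,
      map_add, LinearMap.add_apply]
    abel

/-- `1 ▷ v = v`. -/
lemma extend_one (v : V) : extend D 1 v = v := by
  simp [extend_apply, constMap_apply]

/-- `xA ▷ v = x ▷ (A ▷ v) - (x ▷ A) ▷ v`. -/
lemma extend_ι_mul (x : L) (A : U k L) (v : V) :
    extend D (ι k L x * A) v = D (toAdj x) (extend D A v) - extend D (uDeriv x A) v := by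
  have h := congrArg (fun q => q 1) (rtrans_coindAlg D x A (constMap v))
  have h0 : rtrans x (constMap (k := k) (L := L) v) = 0 := by
    ext C; simp [rtrans_apply, constMap_apply, -UniversalEnvelopingAlgebra.ι_apply]
  simp only [rtrans_apply, one_mul, h0, map_zero, add_zero] at h
  simp only [extend_apply, map_mul, Module.End.mul_apply, coindAlg_ι, coind_one]
  rw [h]

lemma comul_uDeriv (x : L) (A : U k L) : comul k L (uDeriv x A) =
    TensorProduct.map (uDeriv x) LinearMap.id (comul k L A) +
      TensorProduct.map LinearMap.id (uDeriv x) (comul k L A) := by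
  induction A using induct_left with
  | h1 => simp [uDeriv_one, Algebra.TensorProduct.one_def]
  | hadd A B hA hB => simp only [map_add, hA, hB]; abel
  | hsmul c A h => simp only [map_smul, h, smul_add]
  | hmul z A h =>
    simp only [uDeriv_mul, uDeriv_ι, map_add, map_mul, h, comul_ι]
    induction comul k L A using TensorProduct.induction_on with
    | zero => simp
    | add a b ha hb =>
      simp only [map_add, mul_add] at ha hb ⊢
      convert! congrArg₂ (· + ·) ha hb using 1 <;> abel
    | tmul a b =>
      simp [add_mul, mul_add, uDeriv_mul, uDeriv_ι, TensorProduct.tmul_add, TensorProduct.add_tmul, -UniversalEnvelopingAlgebra.ι_apply]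
      abel

/-- `∑ (A₁ ▷ v) (A₂ ▷ w)` for `t = ∑ A₁ ⊗ A₂`. -/
def extendMul {R : Type*} [NonUnitalNonAssocRing R] [Module k R] [IsScalarTower k R R]
    [SMulCommClass k R R] (D : Adj k L →ₗ⁅k⁆ Module.End k R) (v w : R) :
    U k L ⊗[k] U k L →ₗ[k] R :=
  TensorProduct.lift
    ((LinearMap.mul k R).compl₁₂ ((extend D).flip v) ((extend D).flip w))

/-- If `L` acts on `R` by derivations, then `A ▷ (v w) = ∑ (A₁ ▷ v) (A₂ ▷ w)`. -/
lemma extend_mul {R : Type*} [NonUnitalNonAssocRing R] [Module k R] [IsScalarTower k R R]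
    [SMulCommClass k R R] (D : Adj k L →ₗ⁅k⁆ Module.End k R)
    (hD : ∀ x v w, D x (v * w) = D x v * w + v * D x w) (A : U k L) (v w : R) :
    extend D A (v * w) = extendMul D v w (comul k L A) := by
  let P : U k L → Prop := fun A => extend D A (v * w) = extendMul D v w (comul k L A)
  suffices h : ∀ l : List L, P (l.foldl (fun A x => uDeriv x A) A) from h []
  have hadd : ∀ A B, P A → P B → P (A + B) := fun A B hA hB => by
    simp only [P, map_add, LinearMap.add_apply] at hA hB ⊢; rw [hA, hB]
  have hsmul : ∀ (c : k) A, P A → P (c • A) := fun c A hA => by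
    simp only [P, map_smul, LinearMap.smul_apply] at hA ⊢; rw [hA]
  have hstep : ∀ x A, P A → P (uDeriv x A) → P (ι k L x * A) := fun x A hA hA' => by
    simp only [P] at hA hA' ⊢
    rw [extend_ι_mul, hA, hA', comul_uDeriv, map_mul, comul_ι]
    induction comul k L A using TensorProduct.induction_on with
    | zero => simp
    | add a b ha hb => 
      simp only [map_add, mul_add] at ha hb ⊢
      convert! congrArg₂ (· + ·) ha hb using 1 <;> abel
    | tmul a b =>
      simp only [extendMul, add_mul, Algebra.TensorProduct.tmul_mul_tmul, one_mul, map_add,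
        TensorProduct.lift.tmul, LinearMap.compl₁₂_apply, LinearMap.flip_apply,
        LinearMap.mul_apply', TensorProduct.map_tmul, LinearMap.id_apply, extend_ι_mul, hD,
        sub_mul, mul_sub]
      abel
  have fadd : ∀ (l : List L) (A B : U k L), l.foldl (fun A x => uDeriv x A) (A + B) =
      l.foldl (fun A x => uDeriv x A) A + l.foldl (fun A x => uDeriv x A) B := by
    intro l
    induction l with
    | nil => intro A B; rfl
    | cons x l ih => intro A B; simp only [List.foldl_cons, map_add, ih]
  have fsmul : ∀ (l : List L) (c : k) (A : U k L), l.foldl (fun A x => uDeriv x A) (c • A) =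
      c • l.foldl (fun A x => uDeriv x A) A := by
    intro l
    induction l with
    | nil => intro c A; rfl
    | cons x l ih => intro c A; simp only [List.foldl_cons, map_smul, ih]
  induction A using induct_left with
  | h1 =>
    have h0 : P 0 := by simp [P]
    have : ∀ l : List L, P (l.foldl (fun A x => uDeriv x A) 0) := by
      intro l
      induction l with
      | nil => exact h0
      | cons x l ih => simpa using ih
    intro l
    cases l with
    | nil => simp [P, extend_one, extendMul, Algebra.TensorProduct.one_def]
    | cons x l => simpa [uDeriv_one] using this l
  | hadd A B hA hB => intro l; rw [fadd]; exact hadd _ _ (hA l) (hB l)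
  | hsmul c A h => intro l; rw [fsmul]; exact hsmul _ _ (h l)
  | hmul x A h =>
    intro l
    induction l generalizing x A with
    | nil => exact hstep x A (h []) (h [x])
    | cons z l ih =>
      rw [List.foldl_cons, uDeriv_mul, fadd, uDeriv_ι]
      exact hadd _ _ (ih _ _ h) (ih _ _ fun l' => h (z :: l'))

end Extend

variable (k L) in
/-- The post-Lie product `A ▷ B` on `U(L)`. -/
def uTr : U k L →ₗ[k] U k L →ₗ[k] U k L := extend (derivRep k L)

variable (k L) in
/-- The product `A * B = ∑ A₁ (A₂ ▷ B)` on `U(L)`. -/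
def starMul (A B : U k L) : U k L :=
  TensorProduct.lift ((LinearMap.mul k (U k L)).compl₂ ((uTr k L).flip B)) (comul k L A)

variable (k) in
/-- The powers `x * x * ⋯ * x` with respect to the product `*`. -/
def starPow (x : L) : ℕ → U k L
  | 0 => 1
  | n + 1 => starMul k L (ι k L x) (starPow x n)


lemma uTr_one (B : U k L) : uTr k L 1 B = B := extend_one _ B

lemma uTr_ι (x : L) (A : U k L) : uTr k L (ι k L x) A = uDeriv x A := by
  have := extend_ι_mul (derivRep k L) x 1 A
  rwa [mul_one, extend_one, uDeriv_one, map_zero, LinearMap.zero_apply, sub_zero] at this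

lemma uTr_ι_mul (x : L) (A B : U k L) : uTr k L (ι k L x * A) B =
    uTr k L (ι k L x) (uTr k L A B) - uTr k L (uTr k L (ι k L x) A) B := by
  rw [uTr_ι, uTr_ι]; exact extend_ι_mul (derivRep k L) x A B

lemma uTr_ι_ι (x y : L) : uTr k L (ι k L x) (ι k L y) = ι k L (tr k L x y) := by
  rw [uTr_ι, uDeriv_ι]

/-- `A ▷ (B C) = ∑ (A₁ ▷ B) (A₂ ▷ C)`. -/
lemma uTr_mul (A B C : U k L) : uTr k L A (B * C) = TensorProduct.lift
    ((LinearMap.mul k (U k L)).compl₁₂ ((uTr k L).flip B) ((uTr k L).flip C)) (comul k L A) :=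
  extend_mul (derivRep k L) (fun x => uDeriv_mul (toAdj.symm x)) A B C

end Extension
end Algebra
section Geometry

variable {E : Type*} [NormedAddCommGroup E] [NormedSpace ℝ E]
variable {G : Type*} [TopologicalSpace G] [ChartedSpace E G] [Group G]

/-- `V · x`, the image of `V ∈ T₁G` under the derivative of right multiplication by `x`. -/
def rightMul (V : GroupLieAlgebra 𝓘(ℝ, E) G) (x : G) : TangentSpace 𝓘(ℝ, E) x :=
  mfderiv 𝓘(ℝ, E) 𝓘(ℝ, E) (fun y : G => y * x) 1 V

/-- Smooth sections of the trivial bundle `𝔤 × G → G`, that is, smooth maps `f : G → 𝔤`, where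
`𝔤 = T₁G`. (In Mathlib the tangent space `T₁G` is the model space `E` by definition.) -/
def LieSection (E G : Type*) [NormedAddCommGroup E] [NormedSpace ℝ E] [TopologicalSpace G]
    [ChartedSpace E G] := C^∞⟮𝓘(ℝ, E), G; 𝓘(ℝ, E), E⟯

instance : AddCommGroup (LieSection E G) :=
  inferInstanceAs (AddCommGroup C^∞⟮𝓘(ℝ, E), G; 𝓘(ℝ, E), E⟯)

instance : Module ℝ (LieSection E G) :=
  inferInstanceAs (Module ℝ C^∞⟮𝓘(ℝ, E), G; 𝓘(ℝ, E), E⟯)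

instance : FunLike (LieSection E G) G E :=
  inferInstanceAs (FunLike C^∞⟮𝓘(ℝ, E), G; 𝓘(ℝ, E), E⟯ G E)

lemma LieSection.contMDiff (f : LieSection E G) : ContMDiff 𝓘(ℝ, E) 𝓘(ℝ, E) ∞ f :=
  ContMDiffMap.contMDiff f

@[ext] lemma LieSection.ext {f g : LieSection E G} (h : ∀ x, f x = g x) : f = g :=
  ContMDiffMap.ext h

@[simp] lemma LieSection.add_apply (f g : LieSection E G) (x : G) : (f + g) x = f x + g x := rfl
@[simp] lemma LieSection.smul_apply (c : ℝ) (f : LieSection E G) (x : G) :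
    (c • f) x = c • f x := rfl
@[simp] lemma LieSection.zero_apply (x : G) : (0 : LieSection E G) x = 0 := rfl

/-- The vector field `λ(f) : x ↦ f(x) · x`. -/
def anchor (f : LieSection E G) (x : G) : TangentSpace 𝓘(ℝ, E) x := rightMul (G := G) (f x) x

variable {F : Type*} [NormedAddCommGroup F] [NormedSpace ℝ F]

/-- The derivative of `k` at `1`. -/
def derivOne (k : G → F) : E →L[ℝ] F := mfderiv 𝓘(ℝ, E) 𝓘(ℝ, F) k 1

/-- The derivative of `h` in all right-invariant directions: `Dh(x) V = (d/dt) h(exp(tV) x)`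
at `t = 0`. -/
def rightDeriv (h : G → F) (x : G) : E →L[ℝ] F := derivOne fun y : G => h (y * x)

lemma mfderiv_eq_chart {M : Type*} [TopologicalSpace M] [ChartedSpace E M] {h : M → F} {x : M} (hh : MDifferentiableAt 𝓘(ℝ, E) 𝓘(ℝ, F) h x) :
    (mfderiv 𝓘(ℝ, E) 𝓘(ℝ, F) h x : E →L[ℝ] F) =
      fderiv ℝ (h ∘ (extChartAt 𝓘(ℝ, E) x).symm) (extChartAt 𝓘(ℝ, E) x x) := by
  simp only [mfderiv, hh, writtenInExtChartAt, extChartAt_model_space_eq_id,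
    PartialEquiv.refl_coe, Function.id_comp, modelWithCornersSelf_coe, Set.range_id,
    fderivWithin_univ]
  exact if_pos trivial

variable [LieGroup 𝓘(ℝ, E) ∞ G]

lemma contMDiff_translate {h : G → F} (hh : ContMDiff 𝓘(ℝ, E) 𝓘(ℝ, F) ∞ h) (x : G) :
    ContMDiff 𝓘(ℝ, E) 𝓘(ℝ, F) ∞ (fun y : G => h (y * x)) :=
  hh.comp (contMDiff_mul_right (I := 𝓘(ℝ, E)) (n := ∞))

lemma mfderiv_rightMul {h : G → F} (hh : ContMDiff 𝓘(ℝ, E) 𝓘(ℝ, F) ∞ h) (x : G)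
    (V : GroupLieAlgebra 𝓘(ℝ, E) G) :
    mfderiv 𝓘(ℝ, E) 𝓘(ℝ, F) h x (rightMul V x) = rightDeriv (E := E) h x V := by
  have h2 := mfderiv_comp (I := 𝓘(ℝ, E)) (I' := 𝓘(ℝ, E)) (I'' := 𝓘(ℝ, F)) (1 : G)
    (hh.mdifferentiableAt (by simp) (x := (1 : G) * x))
    ((contMDiff_mul_right (I := 𝓘(ℝ, E)) (n := ∞) (a := x)).mdifferentiableAt (by simp))
  have h3 := congrArg (fun φ => φ V) h2
  refine Eq.trans ?_ h3.symm
  simp only [ContinuousLinearMap.comp_apply, rightMul]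
  rw [one_mul]

lemma contMDiff_rightDeriv {h : G → F} (hh : ContMDiff 𝓘(ℝ, E) 𝓘(ℝ, F) ∞ h) :
    ContMDiff 𝓘(ℝ, E) 𝓘(ℝ, E →L[ℝ] F) ∞ (rightDeriv (E := E) h) := by
  intro x₀
  have h1 : ContMDiffAt (𝓘(ℝ, E).prod 𝓘(ℝ, E)) 𝓘(ℝ, F) ∞
      (Function.uncurry fun (x y : G) => h (y * x)) (x₀, 1) :=
    (hh.comp (contMDiff_snd.mul contMDiff_fst)).contMDiffAt
  have h2 := h1.mfderiv (m := ∞) (fun x y => h (y * x)) (fun _ => (1 : G)) contMDiffAt_const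
    (by simp)
  convert! h2 using 1
  funext x
  have : IsManifold 𝓘(ℝ, E) 1 G := IsManifold.of_le (n := ∞) (by simp)
  have h3 := inTangentCoordinates_eq_mfderiv_comp (I := 𝓘(ℝ, E)) (I' := 𝓘(ℝ, F))
    (f := fun _ : G => (1 : G)) (g := fun x : G => h (1 * x))
    (ϕ := fun x : G => mfderiv 𝓘(ℝ, E) 𝓘(ℝ, F) (fun y : G => h (y * x)) 1)
    (x₀ := x₀) (x := x) (mem_chart_source E 1) (Set.mem_univ _)
  refine Eq.trans ?_ h3.symm
  have e1 : mfderivWithin 𝓘(ℝ, E) 𝓘(ℝ, E) (extChartAt 𝓘(ℝ, E) (1 : G)).symm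
      (Set.range 𝓘(ℝ, E)) (extChartAt 𝓘(ℝ, E) (1 : G) 1) = ContinuousLinearMap.id ℝ E :=
    mfderivWithin_range_extChartAt_symm
  have e2 : mfderiv 𝓘(ℝ, F) 𝓘(ℝ, F) (extChartAt 𝓘(ℝ, F) (h (1 * x₀))) (h (1 * x)) =
      ContinuousLinearMap.id ℝ F := by
    rw [extChartAt_model_space_eq_id]; exact mfderiv_id
  ext v
  change _ = mfderiv 𝓘(ℝ, F) 𝓘(ℝ, F) (extChartAt 𝓘(ℝ, F) (h (1 * x₀))) (h (1 * x))
    (mfderiv 𝓘(ℝ, E) 𝓘(ℝ, F) (fun y : G => h (y * x)) 1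
      (mfderivWithin 𝓘(ℝ, E) 𝓘(ℝ, E) (extChartAt 𝓘(ℝ, E) (1 : G)).symm
      (Set.range 𝓘(ℝ, E)) (extChartAt 𝓘(ℝ, E) (1 : G) 1) v))
  rw [e2, e1]
  rfl

section Bracket

/-- The inverse of the chart of `G` at `1`. -/
abbrev cinv (E G : Type*) [NormedAddCommGroup E] [NormedSpace ℝ E] [TopologicalSpace G]
    [ChartedSpace E G] [Group G] : E → G := (extChartAt 𝓘(ℝ, E) (1 : G)).symm

/-- The image of `1` in the chart of `G` at `1`. -/
abbrev cone (E G : Type*) [NormedAddCommGroup E] [NormedSpace ℝ E] [TopologicalSpace G]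
    [ChartedSpace E G] [Group G] : E := extChartAt 𝓘(ℝ, E) (1 : G) 1

/-- The bracket of `T₁G = E` (defined by left-invariant vector fields). -/
def leftBracket (G : Type*) [TopologicalSpace G] [ChartedSpace E G] [Group G] (a b : E) : E :=
  @Bracket.bracket (GroupLieAlgebra 𝓘(ℝ, E) G) (GroupLieAlgebra 𝓘(ℝ, E) G) _ a b

lemma inverse_eq_of_eq_id {T : E →L[ℝ] E} (hT : T = ContinuousLinearMap.id ℝ E) (w : E) :
    T.inverse w = w := by
  rw [hT, ContinuousLinearMap.inverse_id]; rfl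

lemma fderiv_fderiv_swap {N : E × E → F} {e : E} (hN : ContDiffAt ℝ ∞ N (e, e)) (a b : E) :
    fderiv ℝ (fun v => fderiv ℝ (fun u => N (u, v)) e) e a b =
      fderiv ℝ (fun u => fderiv ℝ (fun v => N (u, v)) e) e b a := by
  have hd : ∀ᶠ p in nhds (e, e), DifferentiableAt ℝ N p :=
    ((hN.of_le (m := 2) ENat.LEInfty.out).eventually (by simp)).mono fun p hp => hp.differentiableAt (by simp)
  have hN' : DifferentiableAt ℝ (fderiv ℝ N) (e, e) :=
    ((hN.fderiv_right (m := 1) (by norm_cast)).differentiableAt one_ne_zero)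
  have c1 : ContinuousAt (fun v : E => (e, v)) e := by fun_prop
  have c2 : ContinuousAt (fun u : E => (u, e)) e := by fun_prop
  have h1 : (fun v => fderiv ℝ (fun u => N (u, v)) e) =ᶠ[nhds e]
      fun v => (fderiv ℝ N (e, v)).comp (ContinuousLinearMap.inl ℝ E E) := by
    filter_upwards [c1.eventually hd] with v hv
    exact ((hv.hasFDerivAt).comp e (hasFDerivAt_prodMk_left e v)).fderiv
  have h2 : (fun u => fderiv ℝ (fun v => N (u, v)) e) =ᶠ[nhds e]
      fun u => (fderiv ℝ N (u, e)).comp (ContinuousLinearMap.inr ℝ E E) := by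
    filter_upwards [c2.eventually hd] with u hu
    exact ((hu.hasFDerivAt).comp e (hasFDerivAt_prodMk_right u e)).fderiv
  have k1 : HasFDerivAt (fun v => fderiv ℝ N (e, v))
      ((fderiv ℝ (fderiv ℝ N) (e, e)).comp (ContinuousLinearMap.inr ℝ E E)) e :=
    HasFDerivAt.comp e (f := fun v => (e, v)) hN'.hasFDerivAt (hasFDerivAt_prodMk_right e e)
  have k2 : HasFDerivAt (fun u => fderiv ℝ N (u, e))
      ((fderiv ℝ (fderiv ℝ N) (e, e)).comp (ContinuousLinearMap.inl ℝ E E)) e :=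
    HasFDerivAt.comp e (f := fun u => (u, e)) hN'.hasFDerivAt (hasFDerivAt_prodMk_left e e)
  rw [h1.fderiv_eq, h2.fderiv_eq, (k1.clm_comp (hasFDerivAt_const _ _)).fderiv,
    (k2.clm_comp (hasFDerivAt_const _ _)).fderiv]
  have hs : IsSymmSndFDerivAt ℝ N (e, e) := hN.isSymmSndFDerivAt (by
    rw [minSmoothness_of_isRCLikeNormedField]; exact ENat.LEInfty.out)
  simpa using hs (0, a) (b, 0)

lemma contDiffAt_chart {h : G → F} (hh : ContMDiff 𝓘(ℝ, E) 𝓘(ℝ, F) ∞ h) :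
    ContDiffAt ℝ ∞ (fun p : E × E => h (cinv E G p.1 * cinv E G p.2)) (cone E G, cone E G) := by
  have hc : ContMDiffAt 𝓘(ℝ, E) 𝓘(ℝ, E) ∞ (cinv E G) (cone E G) :=
    (contMDiffOn_extChartAt_symm (I := 𝓘(ℝ, E)) (n := ∞) (1 : G)).contMDiffAt
      (extChartAt_target_mem_nhds (1 : G))
  have h1 : ContMDiffAt (𝓘(ℝ, E).prod 𝓘(ℝ, E)) 𝓘(ℝ, F) ∞
      (fun p : E × E => h (cinv E G p.1 * cinv E G p.2)) (cone E G, cone E G) :=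
    hh.contMDiffAt.comp _ ((hc.comp (cone E G, cone E G) contMDiffAt_fst).mul
      (hc.comp (cone E G, cone E G) contMDiffAt_snd))
  rw [← modelWithCornersSelf_prod, chartedSpaceSelf_prod] at h1
  exact h1.contDiffAt

lemma rightDeriv_eq {h : G → F} (hh : ContMDiff 𝓘(ℝ, E) 𝓘(ℝ, F) ∞ h) (y : G) :
    rightDeriv (E := E) h y = fderiv ℝ (fun u => h (cinv E G u * y)) (cone E G) :=
  mfderiv_eq_chart ((contMDiff_translate hh y).mdifferentiableAt (by simp))

lemma mfderiv_mulInvariant {h : G → F} (hh : ContMDiff 𝓘(ℝ, E) 𝓘(ℝ, F) ∞ h) (y : G)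
    (V : GroupLieAlgebra 𝓘(ℝ, E) G) :
    mfderiv 𝓘(ℝ, E) 𝓘(ℝ, F) h y (mulInvariantVectorField V y) =
      fderiv ℝ (fun v => h (y * cinv E G v)) (cone E G) V := by
  have hl : ContMDiff 𝓘(ℝ, E) 𝓘(ℝ, E) ∞ (fun z : G => y * z) := contMDiff_mul_left
  have h2 := mfderiv_comp (I := 𝓘(ℝ, E)) (I' := 𝓘(ℝ, E)) (I'' := 𝓘(ℝ, F)) (1 : G)
    (hh.mdifferentiableAt (by simp) (x := y * (1 : G)))
    (hl.mdifferentiableAt (by simp))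
  have h3 := congrArg (fun φ => φ V) h2
  have h4 := mfderiv_eq_chart (F := F) (x := (1 : G)) ((hh.comp hl).mdifferentiableAt (by simp))
  refine Eq.trans ?_ (h3.symm.trans (congrArg (fun φ : E →L[ℝ] F => φ V) h4))
  simp only [ContinuousLinearMap.comp_apply, mulInvariantVectorField]
  rw [mul_one]

variable [CompleteSpace E]

lemma mfderiv_bracket {h : G → F} (hh : ContMDiff 𝓘(ℝ, E) 𝓘(ℝ, F) ∞ h)
    (a b : E) :
    rightDeriv h 1 (leftBracket G a b) =
      fderiv ℝ (fun u => fderiv ℝ (fun v => h (cinv E G u * cinv E G v)) (cone E G)) (cone E G) a b -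
      fderiv ℝ (fun u => fderiv ℝ (fun v => h (cinv E G u * cinv E G v)) (cone E G)) (cone E G) b a := by
  have i1 : IsManifold 𝓘(ℝ, E) 1 G := IsManifold.of_le (n := ∞) (by simp)
  have i2 : IsManifold 𝓘(ℝ, E) 2 G := IsManifold.of_le (n := ∞) (by norm_cast)
  have i3 : LieGroup 𝓘(ℝ, E) (minSmoothness ℝ 3) G := by
    rw [minSmoothness_of_isRCLikeNormedField]; infer_instance
  let X : E → E → E := fun a =>
    VectorField.mpullbackWithin 𝓘(ℝ, E) 𝓘(ℝ, E) (cinv E G) (mulInvariantVectorField (G := G) a)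
      (Set.range 𝓘(ℝ, E))
  have hu : (cinv E G ⁻¹' Set.univ ∩ Set.range 𝓘(ℝ, E)) = Set.univ := by simp
  have hX : ∀ a, DifferentiableAt ℝ (X a) (cone E G) := by
    intro a
    have := (mdifferentiableAt_mulInvariantVectorField (I := 𝓘(ℝ, E)) a
      (g := (1 : G))).mdifferentiableWithinAt
        (s := Set.univ) |>.differentiableWithinAt_mpullbackWithin_vectorField
    rw [hu] at this
    exact differentiableWithinAt_univ.1 this
  have hbr : leftBracket G a b = VectorField.lieBracket ℝ (X a) (X b) (cone E G) := by
    have e1 : (mfderiv 𝓘(ℝ, E) 𝓘(ℝ, E) (extChartAt 𝓘(ℝ, E) (1 : G)) 1 : E →L[ℝ] E) =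
      ContinuousLinearMap.id ℝ E := mfderiv_extChartAt_self
    rw [← VectorField.lieBracketWithin_univ, ← hu]
    exact inverse_eq_of_eq_id (E := E) e1 _
  have hc : ContMDiffAt 𝓘(ℝ, E) 𝓘(ℝ, E) ∞ (cinv E G) (cone E G) :=
    (contMDiffOn_extChartAt_symm (I := 𝓘(ℝ, E)) (n := ∞) (1 : G)).contMDiffAt
      (extChartAt_target_mem_nhds (1 : G))
  have hg : ContDiffAt ℝ ∞ (h ∘ cinv E G) (cone E G) :=
    (hh.contMDiffAt.comp _ hc).contDiffAt
  have hXval : ∀ a, ∀ u ∈ (extChartAt 𝓘(ℝ, E) (1 : G)).target,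
      fderiv ℝ (h ∘ cinv E G) u (X a u) =
        fderiv ℝ (fun v => h (cinv E G u * cinv E G v)) (cone E G) a := by
    intro a u hu
    refine Eq.trans ?_ (mfderiv_mulInvariant hh (cinv E G u) a)
    have hi := isInvertible_mfderivWithin_extChartAt_symm (I := 𝓘(ℝ, E)) hu
    have hci : MDifferentiableAt 𝓘(ℝ, E) 𝓘(ℝ, E) (cinv E G) u := by
      have := mdifferentiableWithinAt_extChartAt_symm (I := 𝓘(ℝ, E)) hu
      rwa [modelWithCornersSelf_coe, Set.range_id, mdifferentiableWithinAt_univ] at this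
    have hcomp := mfderiv_comp (I := 𝓘(ℝ, E)) (I' := 𝓘(ℝ, E)) (I'' := 𝓘(ℝ, F)) u
      (hh.mdifferentiableAt (by simp) (x := cinv E G u)) hci
    rw [mfderiv_eq_fderiv] at hcomp
    rw [hcomp]
    have hr : mfderivWithin 𝓘(ℝ, E) 𝓘(ℝ, E) (cinv E G) (Set.range 𝓘(ℝ, E)) u =
        mfderiv 𝓘(ℝ, E) 𝓘(ℝ, E) (cinv E G) u := by
      rw [modelWithCornersSelf_coe, Set.range_id, mfderivWithin_univ]
    have := hi.self_apply_inverse (mulInvariantVectorField a (cinv E G u))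
    refine congrArg (mfderiv 𝓘(ℝ, E) 𝓘(ℝ, F) h (cinv E G u)) ?_
    rw [← hr]
    exact this
  have hXone : ∀ a, X a (cone E G) = a := by
    intro a
    have e1 : (mfderivWithin 𝓘(ℝ, E) 𝓘(ℝ, E) (cinv E G) (Set.range 𝓘(ℝ, E)) (cone E G)
        : E →L[ℝ] E) = ContinuousLinearMap.id ℝ E := mfderivWithin_range_extChartAt_symm
    have e3 : ∀ y : G, y = 1 →
        (mfderiv 𝓘(ℝ, E) 𝓘(ℝ, E) (fun z : G => y * z) 1 : E →L[ℝ] E) =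
          ContinuousLinearMap.id ℝ E := by
      rintro _ rfl
      have : (fun z : G => (1 : G) * z) = id := by ext; simp
      rw [this]; exact mfderiv_id
    refine (inverse_eq_of_eq_id (E := E) e1 _).trans ?_
    exact congrArg (fun φ : E →L[ℝ] E => φ a) (e3 _ (extChartAt_to_inv (1 : G)))
  have hev : ∀ a, (fun u => fderiv ℝ (h ∘ cinv E G) u (X a u)) =ᶠ[nhds (cone E G)]
      fun u => fderiv ℝ (fun v => h (cinv E G u * cinv E G v)) (cone E G) a := fun a => by
    filter_upwards [extChartAt_target_mem_nhds (I := 𝓘(ℝ, E)) (1 : G)] with u hu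
    exact hXval a u hu
  have hdiff : DifferentiableAt ℝ (fun u => fderiv ℝ (fun v => h (cinv E G u * cinv E G v))
      (cone E G)) (cone E G) := by
    have := ContDiffAt.fderiv (m := 1) (n := ∞) (f := fun u v => h (cinv E G u * cinv E G v))
      (g := fun _ => cone E G) (x₀ := cone E G) (contDiffAt_chart hh) contDiffAt_const
      (by norm_cast)
    exact this.differentiableAt one_ne_zero
  have hap : ∀ a c : E, fderiv ℝ (fun u => fderiv ℝ (fun v => h (cinv E G u * cinv E G v))
      (cone E G) a) (cone E G) c = fderiv ℝ (fun u => fderiv ℝ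
        (fun v => h (cinv E G u * cinv E G v)) (cone E G)) (cone E G) c a := fun a c => by
    rw [fderiv_clm_apply hdiff (differentiableAt_const _)]
    simp
  have hm : rightDeriv h 1 = fderiv ℝ (h ∘ cinv E G) (cone E G) := by
    rw [rightDeriv_eq hh]; simp only [mul_one]; rfl
  have key := VectorField.fderiv_apply_lieBracket (hg.of_le (m := 2) ENat.LEInfty.out)
    (by rw [minSmoothness_of_isRCLikeNormedField]) (hX b) (hX a)
  rw [hbr, hm]
  refine key.trans ?_
  rw [(hev a).fderiv_eq, (hev b).fderiv_eq, hXone, hXone, hap, hap]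

lemma rightDeriv_translate (h : G → F) (x y : G) :
    rightDeriv (E := E) (fun z => h (z * x)) y = rightDeriv h (y * x) := by
  have e : (fun z => h (z * y * x)) = fun z => h (z * (y * x)) := by funext z; rw [mul_assoc]
  exact congrArg (derivOne (E := E)) e

/-- The commutator of right-invariant derivatives. -/
lemma rightDeriv_comm {h : G → F} (hh : ContMDiff 𝓘(ℝ, E) 𝓘(ℝ, F) ∞ h) (x : G) (a b : E) :
    rightDeriv (E := E) (rightDeriv (E := E) h) x a b -
      rightDeriv (E := E) (rightDeriv (E := E) h) x b a =
      rightDeriv (E := E) h x (-leftBracket G a b) := by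
  wlog hx : x = 1 generalizing h x
  · have := this (contMDiff_translate hh x) 1 rfl
    have e : rightDeriv (E := E) (fun y => h (y * x)) = fun y => rightDeriv (E := E) h (y * x) :=
      funext fun y => rightDeriv_translate h x y
    rw [e, rightDeriv_translate] at this
    simpa only [one_mul] using this
  subst hx
  have key : ∀ a b, rightDeriv (E := E) (rightDeriv (E := E) h) 1 a b =
      fderiv ℝ (fun u => fderiv ℝ (fun v => h (cinv E G u * cinv E G v)) (cone E G))
        (cone E G) b a := by
    intro a b
    rw [rightDeriv_eq (contMDiff_rightDeriv hh)]
    simp only [mul_one, rightDeriv_eq hh]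
    exact fderiv_fderiv_swap (contDiffAt_chart hh) a b
  rw [key, key, map_neg, mfderiv_bracket hh, neg_sub]

variable {F' : Type*} [NormedAddCommGroup F'] [NormedSpace ℝ F']

lemma differentiableAt_chart {h : G → F} (hh : ContMDiff 𝓘(ℝ, E) 𝓘(ℝ, F) ∞ h) (y : G) :
    DifferentiableAt ℝ (fun u => h (cinv E G u * y)) (cone E G) := by
  have hc : ContMDiffAt 𝓘(ℝ, E) 𝓘(ℝ, E) ∞ (cinv E G) (cone E G) :=
    (contMDiffOn_extChartAt_symm (I := 𝓘(ℝ, E)) (n := ∞) (1 : G)).contMDiffAt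
      (extChartAt_target_mem_nhds (1 : G))
  exact (((contMDiff_translate hh y).contMDiffAt.comp _ hc).contDiffAt).differentiableAt (by simp)

lemma rightDeriv_add {h h' : G → F} (hh : ContMDiff 𝓘(ℝ, E) 𝓘(ℝ, F) ∞ h)
    (hh' : ContMDiff 𝓘(ℝ, E) 𝓘(ℝ, F) ∞ h') (x : G) :
    rightDeriv (E := E) (h + h') x = rightDeriv h x + rightDeriv h' x := by
  rw [rightDeriv_eq (hh.add hh'), rightDeriv_eq hh, rightDeriv_eq hh']
  exact fderiv_add (f := fun u => h (cinv E G u * x)) (g := fun u => h' (cinv E G u * x))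
    (differentiableAt_chart hh x) (differentiableAt_chart hh' x)

lemma contMDiff_bilin {F'' : Type*} [NormedAddCommGroup F''] [NormedSpace ℝ F'']
    (B : F →L[ℝ] F' →L[ℝ] F'') {h : G → F} {h' : G → F'}
    (hh : ContMDiff 𝓘(ℝ, E) 𝓘(ℝ, F) ∞ h) (hh' : ContMDiff 𝓘(ℝ, E) 𝓘(ℝ, F') ∞ h') :
    ContMDiff 𝓘(ℝ, E) 𝓘(ℝ, F'') ∞ (fun y => B (h y) (h' y)) :=
  (B.contDiff.contMDiff.comp hh).clm_apply hh'

/-- The product rule. -/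
lemma rightDeriv_bilin {F'' : Type*} [NormedAddCommGroup F''] [NormedSpace ℝ F'']
    (B : F →L[ℝ] F' →L[ℝ] F'') {h : G → F} {h' : G → F'}
    (hh : ContMDiff 𝓘(ℝ, E) 𝓘(ℝ, F) ∞ h) (hh' : ContMDiff 𝓘(ℝ, E) 𝓘(ℝ, F') ∞ h')
    (x : G) (v : E) :
    rightDeriv (E := E) (fun y => B (h y) (h' y)) x v =
      B (rightDeriv h x v) (h' x) + B (h x) (rightDeriv h' x v) := by
  rw [rightDeriv_eq (contMDiff_bilin B hh hh'), rightDeriv_eq hh, rightDeriv_eq hh']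
  have e : cinv E G (cone E G) = 1 := extChartAt_to_inv (1 : G)
  have := B.fderiv_of_bilinear (differentiableAt_chart hh x) (differentiableAt_chart hh' x)
  rw [this]
  simp [e, add_comm]
end Bracket

section Sections

attribute [local instance] LieRing.ofAssociativeRing LieAlgebra.ofAssociativeAlgebra

/-- The derivative `λ(f)(h)` of a smooth map `h : G → F` along the vector field `λ(f)`. -/
def dirDeriv (f : LieSection E G) (h : C^∞⟮𝓘(ℝ, E), G; 𝓘(ℝ, F), F⟯) :
    C^∞⟮𝓘(ℝ, E), G; 𝓘(ℝ, F), F⟯ :=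
  ⟨fun x => mfderiv 𝓘(ℝ, E) 𝓘(ℝ, F) h x (anchor f x), by
    have : (fun x => mfderiv 𝓘(ℝ, E) 𝓘(ℝ, F) h x (anchor f x)) =
        fun x => rightDeriv (E := E) h x (f x) :=
      funext fun x => mfderiv_rightMul h.contMDiff x (f x)
    rw [this]
    exact (contMDiff_rightDeriv h.contMDiff).clm_apply f.contMDiff⟩

lemma dirDeriv_apply (f : LieSection E G) (h : C^∞⟮𝓘(ℝ, E), G; 𝓘(ℝ, F), F⟯) (x : G) :
    dirDeriv f h x = rightDeriv (E := E) h x (f x) := mfderiv_rightMul h.contMDiff x (f x)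

variable [FiniteDimensional ℝ E]

lemma leftBracket_lie (G : Type*) [TopologicalSpace G] [ChartedSpace E G] [Group G]
    [LieGroup 𝓘(ℝ, E) ∞ G] :
    (∀ a b c : E, leftBracket G (a + b) c = leftBracket G a c + leftBracket G b c) ∧
    (∀ a b c : E, leftBracket G a (b + c) = leftBracket G a b + leftBracket G a c) ∧
    (∀ a : E, leftBracket G a a = 0) ∧
    (∀ a b c : E, leftBracket G a (leftBracket G b c) =
      leftBracket G (leftBracket G a b) c + leftBracket G b (leftBracket G a c)) ∧
    (∀ (t : ℝ) (a b : E), leftBracket G a (t • b) = t • leftBracket G a b) ∧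
    (∀ (t : ℝ) (a b : E), leftBracket G (t • a) b = t • leftBracket G a b) := by
  have i3 : LieGroup 𝓘(ℝ, E) (minSmoothness ℝ 3) G := by
    rw [minSmoothness_of_isRCLikeNormedField]; infer_instance
  have i4 : CompleteSpace E := FiniteDimensional.complete ℝ E
  exact ⟨fun a b c => add_lie (L := GroupLieAlgebra 𝓘(ℝ, E) G) (M := GroupLieAlgebra 𝓘(ℝ, E) G) a b c,
    fun a b c => lie_add (L := GroupLieAlgebra 𝓘(ℝ, E) G) (M := GroupLieAlgebra 𝓘(ℝ, E) G) a b c,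
    fun a => lie_self (L := GroupLieAlgebra 𝓘(ℝ, E) G) a,
    fun a b c => leibniz_lie (L₁ := GroupLieAlgebra 𝓘(ℝ, E) G)
      (L₂ := GroupLieAlgebra 𝓘(ℝ, E) G)
      (M := GroupLieAlgebra 𝓘(ℝ, E) G) a b c,
    fun t a b => lie_smul (R := ℝ) (L := GroupLieAlgebra 𝓘(ℝ, E) G)
      (M := GroupLieAlgebra 𝓘(ℝ, E) G) t a b,
    fun t a b => smul_lie (R := ℝ) (L := GroupLieAlgebra 𝓘(ℝ, E) G)
      (M := GroupLieAlgebra 𝓘(ℝ, E) G) t a b⟩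

/-- The bracket `[·,·]_𝔤` of `𝔤 = T₁G` defined by right-invariant vector fields, that is, the bracket
for which `V ↦ (x ↦ V · x)` is a morphism of Lie algebras to the vector fields on `G`; it is the
opposite of the bracket defined by left-invariant vector fields. -/
def rightBracket (G : Type*) [TopologicalSpace G] [ChartedSpace E G] [Group G]
    [LieGroup 𝓘(ℝ, E) ∞ G] : E →L[ℝ] E →L[ℝ] E :=
  LinearMap.toContinuousBilinearMap (LinearMap.mk₂ ℝ (fun a b => -leftBracket G a b)
    (fun a b c => by simp only [(leftBracket_lie (E := E) G).1]; abel)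
    (fun t a b => by simp only [(leftBracket_lie (E := E) G).2.2.2.2.2, smul_neg])
    (fun a b c => by simp only [(leftBracket_lie (E := E) G).2.1]; abel)
    (fun t a b => by simp only [(leftBracket_lie (E := E) G).2.2.2.2.1, smul_neg]))

lemma rightBracket_apply (a b : E) : rightBracket G a b = -leftBracket G a b := rfl

lemma rightBracket_self (a : E) : rightBracket G a a = 0 := by
  rw [rightBracket_apply, (leftBracket_lie (E := E) G).2.2.1, neg_zero]

lemma rightBracket_jacobi (a b c : E) : rightBracket G a (rightBracket G b c) =
    rightBracket G (rightBracket G a b) c + rightBracket G b (rightBracket G a c) := by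
  have h := (leftBracket_lie (E := E) G).2.2.2.1 a b c
  have hn : ∀ a b : E, leftBracket G a b = -rightBracket G a b := fun a b => by
    rw [rightBracket_apply, neg_neg]
  simpa only [hn, map_neg, neg_apply, neg_neg] using h

/-- The pointwise bracket `[f, g](x) = [f(x), g(x)]_𝔤`. -/
instance : Bracket (LieSection E G) (LieSection E G) where
  bracket f g := ⟨fun x => rightBracket G (f x) (g x),
    contMDiff_bilin (rightBracket G) f.contMDiff g.contMDiff⟩

lemma LieSection.bracket_apply (f g : LieSection E G) (x : G) :
    ⁅f, g⁆ x = rightBracket G (f x) (g x) := rfl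

instance : LieRing (LieSection E G) where
  add_lie f g h := by ext x; simp [LieSection.bracket_apply]
  lie_add f g h := by ext x; simp [LieSection.bracket_apply]
  lie_self f := by ext x; simp [LieSection.bracket_apply, rightBracket_self]
  leibniz_lie f g h := by
    ext x; simp only [LieSection.bracket_apply, LieSection.add_apply]
    exact rightBracket_jacobi _ _ _

instance : LieAlgebra ℝ (LieSection E G) where
  lie_smul c f g := by ext x; simp [LieSection.bracket_apply]

variable (E G F) in
/-- `dirDeriv` as a bilinear map. -/
def dirDerivL : LieSection E G →ₗ[ℝ] Module.End ℝ C^∞⟮𝓘(ℝ, E), G; 𝓘(ℝ, F), F⟯ :=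
  LinearMap.mk₂ ℝ dirDeriv
    (fun f g h => by ext x; simp [dirDeriv_apply])
    (fun c f h => by ext x; simp [dirDeriv_apply])
    (fun f h h' => by
      ext x
      simp only [dirDeriv_apply, ContMDiffMap.coe_add, Pi.add_apply,
        rightDeriv_add h.contMDiff h'.contMDiff, add_apply])
    (fun c f h => by
      ext x
      have e : (⇑(c • h) : G → F) = fun y => (ContinuousLinearMap.lsmul ℝ ℝ : ℝ →L[ℝ] F →L[ℝ] F)
        ((fun _ : G => c) y) (h y) := rfl
      have z : rightDeriv (E := E) (fun _ : G => c) x = 0 := by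
        rw [rightDeriv_eq contMDiff_const]; simp
      simp only [dirDeriv_apply, ContMDiffMap.coe_smul, Pi.smul_apply]
      simp only [ContMDiffMap.coe_smul] at e
      rw [e, rightDeriv_bilin _ contMDiff_const h.contMDiff, z]
      simp)

lemma dirDeriv_comp (f g : LieSection E G) (h : C^∞⟮𝓘(ℝ, E), G; 𝓘(ℝ, F), F⟯) (x : G) :
    dirDeriv f (dirDeriv g h) x = rightDeriv (E := E) (rightDeriv (E := E) h) x (f x) (g x) +
      rightDeriv (E := E) h x (rightDeriv (E := E) g x (f x)) := by
  rw [dirDeriv_apply]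
  have e : (⇑(dirDeriv g h) : G → F) = fun y =>
      (ContinuousLinearMap.id ℝ (E →L[ℝ] F)) (rightDeriv (E := E) h y) (g y) :=
    funext fun y => dirDeriv_apply g h y
  rw [e, rightDeriv_bilin _ (contMDiff_rightDeriv h.contMDiff) g.contMDiff]
  rfl

/-- `f ▷ g`, the derivative of `g` along the vector field `λ(f)`. -/
def conn (f g : LieSection E G) : LieSection E G := dirDeriv (F := E) f g

lemma conn_apply (f g : LieSection E G) (x : G) : conn f g x = rightDeriv (E := E) g x (f x) :=
  dirDeriv_apply (F := E) f g x

/-- `[f, g] ▷ h = f ▷ (g ▷ h) - (f ▷ g) ▷ h - g ▷ (f ▷ h) + (g ▷ f) ▷ h`. -/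
lemma dirDeriv_bracket (f g : LieSection E G) (h : C^∞⟮𝓘(ℝ, E), G; 𝓘(ℝ, F), F⟯) :
    dirDeriv ⁅f, g⁆ h = (dirDeriv f (dirDeriv g h) - dirDeriv (conn f g) h) -
      (dirDeriv g (dirDeriv f h) - dirDeriv (conn g f) h) := by
  have i4 : CompleteSpace E := FiniteDimensional.complete ℝ E
  ext x
  have key := rightDeriv_comm h.contMDiff x (f x) (g x)
  simp only [ContMDiffMap.coe_sub, Pi.sub_apply, dirDeriv_comp]
  rw [dirDeriv_apply, dirDeriv_apply, dirDeriv_apply, conn_apply, conn_apply,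
    LieSection.bracket_apply, rightBracket_apply, ← key]
  abel

/-- `𝔏 = (𝔤^G, [·,·], ▷)` as a post-Lie algebra. -/
instance : PostLieAlgebra ℝ (LieSection E G) where
  prod := dirDerivL E G E
  prod_lie f g h := by
    ext x
    exact (dirDeriv_apply (F := E) f (⁅g, h⁆ : LieSection E G) x).trans <|
      (rightDeriv_bilin (rightBracket G) g.contMDiff h.contMDiff x (f x)).trans <| by
        rw [← conn_apply, ← conn_apply]; rfl
  lie_prod f g h := dirDeriv_bracket (F := E) f g h

lemma tr_apply (f g : LieSection E G) : tr ℝ (LieSection E G) f g = conn f g := rfl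

variable (E G) in
/-- The action `f ▷ φ = λ(f)(φ)` of `𝔏` on scalar functions, as a representation of the Lie algebra
`(𝔤^G, ⟦·,·⟧)`. -/
def scalarRep : Adj ℝ (LieSection E G) →ₗ⁅ℝ⁆ Module.End ℝ C^∞⟮𝓘(ℝ, E), G; 𝓘(ℝ), ℝ⟯ :=
  { toFun := fun f => dirDerivL E G ℝ (toAdj.symm f)
    map_add' := fun f g => by simp
    map_smul' := fun c f => by simp
    map_lie' := fun {f g} => by
      ext φ x
      obtain ⟨f, rfl⟩ := (toAdj (k := ℝ) (L := LieSection E G)).surjective f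
      obtain ⟨g, rfl⟩ := (toAdj (k := ℝ) (L := LieSection E G)).surjective g
      rw [lie_toAdj, dbl, LinearEquiv.symm_apply_apply, map_add, map_sub]
      change (dirDeriv (conn f g) φ - dirDeriv (conn g f) φ + dirDeriv ⁅f, g⁆ φ) x =
        (dirDeriv f (dirDeriv g φ) - dirDeriv g (dirDeriv f φ)) x
      rw [dirDeriv_bracket]
      congr 1
      abel }

/-- The action `A ▷ φ` of `A ∈ U(𝔏)` on scalar functions `φ`. -/
def scalarAct (A : U ℝ (LieSection E G)) (φ : C^∞⟮𝓘(ℝ, E), G; 𝓘(ℝ), ℝ⟯) :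
    C^∞⟮𝓘(ℝ, E), G; 𝓘(ℝ), ℝ⟯ := extend (scalarRep E G) A φ

lemma scalarAct_one (φ : C^∞⟮𝓘(ℝ, E), G; 𝓘(ℝ), ℝ⟯) : scalarAct 1 φ = φ := extend_one _ φ

lemma scalarAct_ι (f : LieSection E G) (φ : C^∞⟮𝓘(ℝ, E), G; 𝓘(ℝ), ℝ⟯) :
    scalarAct (ι ℝ _ f) φ = dirDeriv f φ := by
  have := extend_ι_mul (scalarRep E G) f 1 φ
  rwa [mul_one, extend_one, uDeriv_one, map_zero, LinearMap.zero_apply, sub_zero] at this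

lemma scalarAct_ι_mul (f : LieSection E G) (A : U ℝ (LieSection E G))
    (φ : C^∞⟮𝓘(ℝ, E), G; 𝓘(ℝ), ℝ⟯) : scalarAct (ι ℝ _ f * A) φ =
      dirDeriv f (scalarAct A φ) - scalarAct (uTr ℝ _ (ι ℝ _ f) A) φ := by
  rw [uTr_ι]; exact extend_ι_mul (scalarRep E G) f A φ

lemma scalarAct_mul (A : U ℝ (LieSection E G)) (φ φ' : C^∞⟮𝓘(ℝ, E), G; 𝓘(ℝ), ℝ⟯) :
    scalarAct A (φ * φ') = extendMul (scalarRep E G) φ φ' (comul ℝ _ A) :=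
  extend_mul (scalarRep E G) (fun f φ φ' => by
    ext x
    change dirDeriv (toAdj.symm f) (φ * φ') x =
      dirDeriv (toAdj.symm f) φ x * φ' x + φ x * dirDeriv (toAdj.symm f) φ' x
    simp only [dirDeriv_apply]
    exact rightDeriv_bilin (ContinuousLinearMap.mul ℝ ℝ) φ.contMDiff φ'.contMDiff x _) A φ φ'

/-- `exp*(tf) = ∑ tⁿ/n! f * ⋯ * f` as a formal power series in `t` with coefficients in `U(𝔏)`. -/
def expStar (f : LieSection E G) : PowerSeries (U ℝ (LieSection E G)) :=
  PowerSeries.mk fun n => ((n.factorial : ℝ)⁻¹) • starPow ℝ f n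

/-- The action of a power series over `U(𝔏)` on a scalar function, coefficient by coefficient. -/
def seriesAct (α : PowerSeries (U ℝ (LieSection E G))) (φ : C^∞⟮𝓘(ℝ, E), G; 𝓘(ℝ), ℝ⟯) :
    PowerSeries C^∞⟮𝓘(ℝ, E), G; 𝓘(ℝ), ℝ⟯ :=
  PowerSeries.mk fun n => scalarAct (PowerSeries.coeff n α) φ

end Sections

/-- The time-`t` flow of the vector field `X`: the value at time `t` of an integral curve of `X` which
starts at `x` and is defined on an open interval that contains `0` and `t`, if there is such a curve;
where the flow is not defined, the value is `x`. -/
def flow {M : Type*} [TopologicalSpace M] [ChartedSpace E M]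
    (X : (x : M) → TangentSpace 𝓘(ℝ, E) x) (t : ℝ) (x : M) : M :=
  open Classical in
  if h : ∃ γ : ℝ → M, γ 0 = x ∧ ∃ a b : ℝ, 0 ∈ Set.Ioo a b ∧ t ∈ Set.Ioo a b ∧
      IsMIntegralCurveOn γ X (Set.Ioo a b)
  then h.choose t else x

/-- The pullback `(ψ^← φ)(x) = φ(ψ(x))`. -/
def pullback {M : Type*} (ψ : M → M) (φ : M → ℝ) (x : M) : ℝ := φ (ψ x)

end Geometry

end

end PostLie

/-! Write `D = λ(f)` for the derivation of `C^∞(G)` given by the vector field of `f`. Both sides of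
the theorem are the Lie series of `D`: the `n`-th Taylor coefficient of each is `Dⁿφ / n!`,
evaluated at `x` on the flow side.

Algebraic side. The product `*` is made so that acting with `A * B` means acting with `B` and then
with `A`. Only the case `A = f ∈ 𝔏` is needed. Since `f` is primitive, `f * B = f B + f ▷ B`; the
recursion `f B ▷ φ = f ▷ (B ▷ φ) - (f ▷ B) ▷ φ` carries a correction term which the summand `f ▷ B`
cancels exactly. This is `scalarAct_starMul_ι`. By induction `f^{*n} ▷ φ = Dⁿφ`, which is
`scalarAct_starPow`.

Analytic side. If `γ` is an integral curve of `λ(f)`, the chain rule gives `(φ ∘ γ)' = (Dφ) ∘ γ`.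
Because `Dφ` is again a smooth function on `G`, this one formula can be iterated: it shows at once
that `φ ∘ γ` is smooth (`contDiffOn_comp_integralCurve`) and that its `n`-th derivative is `(Dⁿφ) ∘
γ` (`iteratedDeriv_comp_integralCurve`).

The bridge is ODE theory. The flow at each time is the value of some chosen integral curve, possibly
a different one for each `t`. Smoothness of `λ(f)` (`contMDiff_anchor`) gives a local integral curve
`γ` through `x`, and uniqueness in the Hausdorff manifold `G` makes all choices agree with `γ` near
`0` (`flow_eq_of_isMIntegralCurveOn`). Derivatives at `0` depend only on the germ there, so the flow
can be replaced by `γ`. -/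

namespace PostLie

/-! ### The star product acts on functions by composition of derivations. -/

section StarAction

variable {E : Type*} [NormedAddCommGroup E] [NormedSpace ℝ E] [FiniteDimensional ℝ E]
  {G : Type*} [TopologicalSpace G] [ChartedSpace E G] [Group G] [LieGroup 𝓘(ℝ, E) ∞ G]

/-- `x * B = x B + x ▷ B` for `x ∈ L`. -/
lemma starMul_ι {k L : Type*} [CommRing k] [LieRing L] [LieAlgebra k L] [PostLieAlgebra k L]
    (x : L) (B : U k L) : starMul k L (ι k L x) B = ι k L x * B + uTr k L (ι k L x) B := by
  -- Primitivity of `x` leaves two terms, `x (1 ▷ B)` and `1 (x ▷ B)`.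
  rw [starMul, comul_ι]
  simp only [map_add, TensorProduct.lift.tmul, LinearMap.compl₂_apply, LinearMap.flip_apply,
    LinearMap.mul_apply', uTr_one, one_mul]

/-- `(f * B) ▷ φ = f ▷ (B ▷ φ)` for `f ∈ 𝔏`. -/
lemma scalarAct_starMul_ι (f : LieSection E G) (B : U ℝ (LieSection E G))
    (φ : C^∞⟮𝓘(ℝ, E), G; 𝓘(ℝ), ℝ⟯) :
    scalarAct (starMul ℝ _ (ι ℝ _ f) B) φ = dirDeriv f (scalarAct B φ) := by
  have h : scalarAct (ι ℝ _ f * B + uTr ℝ _ (ι ℝ _ f) B) φ =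
      scalarAct (ι ℝ _ f * B) φ + scalarAct (uTr ℝ _ (ι ℝ _ f) B) φ := by
    simp only [scalarAct, map_add, LinearMap.add_apply]
  -- The correction `-(f ▷ B) ▷ φ` in the recursion for `f B` cancels against the second summand of
  -- `f * B`.
  rw [starMul_ι, h, scalarAct_ι_mul, sub_add_cancel]

/-- Each further factor `f` enters the star power on the left, hence acts last and contributes one
more outer derivative along `λ(f)`. All reference to the enveloping algebra disappears here. -/
lemma scalarAct_starPow (f : LieSection E G) (n : ℕ) (φ : C^∞⟮𝓘(ℝ, E), G; 𝓘(ℝ), ℝ⟯) :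
    scalarAct (starPow ℝ f n) φ = (dirDeriv f)^[n] φ := by
  induction n with
  | zero => exact scalarAct_one φ
  | succ n ih => rw [starPow, scalarAct_starMul_ι, ih, Function.iterate_succ_apply']

lemma coeff_seriesAct_expStar (f : LieSection E G) (φ : C^∞⟮𝓘(ℝ, E), G; 𝓘(ℝ), ℝ⟯) (n : ℕ) :
    PowerSeries.coeff n (seriesAct (expStar f) φ) =
      (n.factorial : ℝ)⁻¹ • (dirDeriv f)^[n] φ := by
  rw [seriesAct, PowerSeries.coeff_mk, expStar, PowerSeries.coeff_mk, ← scalarAct_starPow]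
  simp only [scalarAct, map_smul, LinearMap.smul_apply]

end StarAction

/-! ### Local uniqueness of integral curves and the flow. -/

section Flow

open Set Filter Topology

variable {E : Type*} [NormedAddCommGroup E] [NormedSpace ℝ E]

/-- Near `t = 0` the flow agrees with any integral curve through the given point. -/
lemma flow_eq_of_isMIntegralCurveOn {M : Type*} [TopologicalSpace M] [T2Space M]
    [ChartedSpace E M] [IsManifold 𝓘(ℝ, E) 1 M] {X : (x : M) → TangentSpace 𝓘(ℝ, E) x}
    (hX : ContMDiff 𝓘(ℝ, E) 𝓘(ℝ, E).tangent 1 fun x => (⟨x, X x⟩ : TangentBundle 𝓘(ℝ, E) M))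
    {γ : ℝ → M} {a b : ℝ} (h0 : (0 : ℝ) ∈ Ioo a b) (hγ : IsMIntegralCurveOn γ X (Ioo a b))
    {t : ℝ} (ht : t ∈ Ioo a b) : flow X t (γ 0) = γ t := by
  -- The curve `γ` itself witnesses that the flow is defined at `t`, so the default value in the
  -- definition of `flow` plays no role.
  have h : ∃ γ' : ℝ → M, γ' 0 = γ 0 ∧ ∃ a b : ℝ, 0 ∈ Ioo a b ∧ t ∈ Ioo a b ∧
      IsMIntegralCurveOn γ' X (Ioo a b) := ⟨γ, rfl, a, b, h0, ht, hγ⟩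
  rw [flow, dif_pos h]
  obtain ⟨h1, a', b', h0', ht', hγ'⟩ := h.choose_spec
  -- The chosen curve lives on its own interval. Uniqueness is applied on the intersection of the
  -- two, an open interval which still contains both `0` and `t`.
  have m : ∀ {s : ℝ}, s ∈ Ioo a b → s ∈ Ioo a' b' → s ∈ Ioo (max a a') (min b b') :=
    fun h h' => ⟨max_lt h.1 h'.1, lt_min h.2 h'.2⟩
  exact isMIntegralCurveOn_Ioo_eqOn_of_contMDiff_boundaryless (m h0 h0') hX
    (hγ'.mono (Ioo_subset_Ioo (le_max_right _ _) (min_le_right _ _)))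
    (hγ.mono (Ioo_subset_Ioo (le_max_left _ _) (min_le_left _ _))) h1 (m ht ht')

/-! ### Smoothness of the vector field of a section. -/

variable {G : Type*} [TopologicalSpace G] [ChartedSpace E G] [Group G] [LieGroup 𝓘(ℝ, E) ∞ G]

/-- The vector field `λ(f)` is smooth. -/
lemma contMDiff_anchor (f : LieSection E G) : ContMDiff 𝓘(ℝ, E) 𝓘(ℝ, E).tangent ∞
    fun x => (⟨x, anchor f x⟩ : TangentBundle 𝓘(ℝ, E) G) := by
  have : IsManifold 𝓘(ℝ, E) 1 G := IsManifold.of_le (n := ∞) (by simp)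
  -- With `m` the multiplication of `G`, `f(x) · x` is the tangent map of `m` at `(1, x)` applied to
  -- `(f(x), 0)`. So the field is the composite of `Tm` with two smooth maps into `TG`: the zero
  -- section, and `f` seen as a map into the fibre over `1`.
  let fg : G → TangentBundle 𝓘(ℝ, E) G := fun x => ⟨x, 0⟩
  have sfg : ContMDiff 𝓘(ℝ, E) 𝓘(ℝ, E).tangent ∞ fg := Bundle.contMDiff_zeroSection _ _
  let fv : G → TangentBundle 𝓘(ℝ, E) G := fun x => ⟨1, f x⟩
  have sfv : ContMDiff 𝓘(ℝ, E) 𝓘(ℝ, E).tangent ∞ fv := by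
    intro x
    rw [Bundle.contMDiffAt_totalSpace]
    refine ⟨contMDiffAt_const, ?_⟩
    -- The base point stays at `1`, so the trivialization there is a coordinate change from a chart
    -- to itself, the identity on the fibre.
    convert! f.contMDiff x using 1
    funext y
    exact tangentCoordChange_self (I := 𝓘(ℝ, E)) (x := (1 : G)) (v := f y)
      (mem_extChartAt_source (1 : G))
  have hm : ContMDiff (𝓘(ℝ, E).prod 𝓘(ℝ, E)) 𝓘(ℝ, E) ∞ fun p : G × G => p.1 * p.2 :=
    contMDiff_mul 𝓘(ℝ, E) ∞
  have S := ((hm.contMDiff_tangentMap (m := ∞) le_rfl).comp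
    (contMDiff_equivTangentBundleProd_symm (I := 𝓘(ℝ, E)) (I' := 𝓘(ℝ, E)) (M := G)
      (M' := G))).comp (sfv.prodMk sfg)
  convert! S with x
  · simp [fg, fv]
  · simp only [Function.comp_apply, tangentMap, fg, fv]
    -- The derivative of `m` splits into its two partial derivatives; the second is applied to the
    -- zero vector and vanishes.
    rw [mfderiv_prod_eq_add_apply (hm.mdifferentiableAt (by simp))]
    change mfderiv 𝓘(ℝ, E) 𝓘(ℝ, E) (fun y : G => y * x) 1 (f x) =
      mfderiv 𝓘(ℝ, E) 𝓘(ℝ, E) (fun y : G => y * x) 1 (f x) +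
        mfderiv 𝓘(ℝ, E) 𝓘(ℝ, E) (fun y : G => 1 * y) x 0
    rw [map_zero]
    exact (add_zero _).symm

/-! ### Derivatives of functions along integral curves. -/

/-- The chain rule, since the velocity of `γ` is `λ(f)` at `γ t`. The derivative has the same shape
as the function, with `Dφ` in place of `φ`, and this is what lets the next two inductions run. -/
lemma hasDerivAt_comp_integralCurve {f : LieSection E G} {γ : ℝ → G} {s : Set ℝ}
    (hs : IsOpen s) (hγ : IsMIntegralCurveOn γ (anchor f) s)
    (φ : C^∞⟮𝓘(ℝ, E), G; 𝓘(ℝ), ℝ⟯) {t : ℝ} (ht : t ∈ s) :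
    HasDerivAt (fun t => φ (γ t)) (dirDeriv f φ (γ t)) t := by
  have h := ((φ.contMDiff.mdifferentiableAt (by simp) (x := γ t)).hasMFDerivAt).comp t
    ((hγ t ht).hasMFDerivAt (hs.mem_nhds ht))
  -- Naming the differential and the velocity with types over `E` identifies the tangent spaces with
  -- the model space, so that the manifold derivative can be read as an ordinary one.
  let A : E →L[ℝ] ℝ := mfderiv 𝓘(ℝ, E) 𝓘(ℝ, ℝ) φ (γ t)
  let v : E := anchor f (γ t)
  have h2 : HasFDerivAt (fun t => φ (γ t)) (A.comp ((1 : ℝ →L[ℝ] ℝ).smulRight v)) t :=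
    hasMFDerivAt_iff_hasFDerivAt.1 h
  have e : (A.comp ((1 : ℝ →L[ℝ] ℝ).smulRight v)) 1 = A v := by simp
  exact e ▸ h2.hasDerivAt

/-- Bootstrapping: if `(Dφ) ∘ γ` is `C^n`, then `φ ∘ γ` is `C^(n+1)`. The induction therefore runs
over all `φ` at once. -/
lemma contDiffOn_comp_integralCurve {f : LieSection E G} {γ : ℝ → G} {s : Set ℝ}
    (hs : IsOpen s) (hγ : IsMIntegralCurveOn γ (anchor f) s)
    (φ : C^∞⟮𝓘(ℝ, E), G; 𝓘(ℝ), ℝ⟯) : ContDiffOn ℝ ∞ (fun t => φ (γ t)) s := by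
  rw [contDiffOn_infty]
  intro n
  have hd := fun (φ : C^∞⟮𝓘(ℝ, E), G; 𝓘(ℝ), ℝ⟯) {t : ℝ} (ht : t ∈ s) =>
    hasDerivAt_comp_integralCurve hs hγ φ ht
  induction n generalizing φ with
  | zero =>
    exact contDiffOn_zero.2 fun t ht => (hd φ ht).continuousAt.continuousWithinAt
  | succ n ih =>
    push_cast
    rw [contDiffOn_succ_iff_deriv_of_isOpen hs]
    exact ⟨fun t ht => (hd φ ht).differentiableAt.differentiableWithinAt, by simp,
      (ih (dirDeriv f φ)).congr fun t ht => (hd φ ht).deriv⟩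

lemma iteratedDeriv_comp_integralCurve {f : LieSection E G} {γ : ℝ → G} {s : Set ℝ}
    (hs : IsOpen s) (hγ : IsMIntegralCurveOn γ (anchor f) s) (n : ℕ)
    (φ : C^∞⟮𝓘(ℝ, E), G; 𝓘(ℝ), ℝ⟯) {t : ℝ} (ht : t ∈ s) :
    iteratedDeriv n (fun t => φ (γ t)) t = (dirDeriv f)^[n] φ (γ t) := by
  induction n generalizing φ with
  | zero => simp
  | succ n ih =>
    -- Equality at `t` alone would not survive further differentiation; openness of `s` gives it on
    -- a neighbourhood.
    have e : deriv (fun t => φ (γ t)) =ᶠ[𝓝 t] fun t => dirDeriv f φ (γ t) :=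
      (hs.eventually_mem ht).mono fun u hu => (hasDerivAt_comp_integralCurve hs hγ φ hu).deriv
    -- The innermost derivative is taken off first, matching `D^(n+1) φ = D^n (Dφ)`, so the
    -- induction hypothesis is used at `Dφ`.
    rw [iteratedDeriv_succ', e.iteratedDeriv_eq n, ih, Function.iterate_succ_apply]

end Flow

end PostLie

/-! ### The Taylor series of the pullback by the flow. -/

theorem mainTheorem10 {E : Type*} [NormedAddCommGroup E] [NormedSpace ℝ E]
    [FiniteDimensional ℝ E] {G : Type*} [TopologicalSpace G] [T2Space G] [ChartedSpace E G]
    [Group G] [LieGroup 𝓘(ℝ, E) ∞ G]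
    (f : PostLie.LieSection E G) (φ : C^∞⟮𝓘(ℝ, E), G; 𝓘(ℝ), ℝ⟯) (x : G) :
    ContDiffAt ℝ ∞ (fun t : ℝ => PostLie.pullback (PostLie.flow (PostLie.anchor f) t) φ x) 0 ∧
      ∀ n : ℕ,
        iteratedDeriv n
            (fun t : ℝ => PostLie.pullback (PostLie.flow (PostLie.anchor f) t) φ x) 0 /
          (n.factorial : ℝ) =
        PowerSeries.coeff n (PostLie.seriesAct (PostLie.expStar f) φ) x := by
  have : IsManifold 𝓘(ℝ, E) 1 G := IsManifold.of_le (n := ∞) (by simp)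
  have : CompleteSpace E := FiniteDimensional.complete ℝ E
  have hX := (PostLie.contMDiff_anchor f).of_le (m := 1) (by simp)
  -- Picard–Lindelöf, available because `E` is complete and the field is `C^1`. From here on `x` is
  -- written `γ 0`.
  obtain ⟨γ, rfl, hγ⟩ := exists_isMIntegralCurveAt_of_contMDiffAt_boundaryless
    (v := PostLie.anchor f) 0 (hX.contMDiffAt (x := x))
  obtain ⟨ε, hε, hγ⟩ := isMIntegralCurveAt_iff'.1 hγ
  rw [Real.ball_eq_Ioo] at hγ
  have h0 : (0 : ℝ) ∈ Set.Ioo (0 - ε) (0 + ε) := by simpa using hε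
  have hn := isOpen_Ioo.mem_nhds h0
  -- The flow and the single curve `γ` have the same germ at `t = 0`, which is all that both claims
  -- involve.
  have e : (fun t : ℝ => PostLie.pullback (PostLie.flow (PostLie.anchor f) t) φ (γ 0)) =ᶠ[nhds 0]
      fun t => φ (γ t) := by
    filter_upwards [hn] with t ht
    rw [PostLie.pullback, PostLie.flow_eq_of_isMIntegralCurveOn hX h0 hγ ht]
  refine ⟨((PostLie.contDiffOn_comp_integralCurve isOpen_Ioo hγ φ).contDiffAt
    hn).congr_of_eventuallyEq e, fun n => ?_⟩
  rw [e.iteratedDeriv_eq n, PostLie.iteratedDeriv_comp_integralCurve isOpen_Ioo hγ n φ h0,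
    PostLie.coeff_seriesAct_expStar, ContMDiffMap.coe_smul, Pi.smul_apply, smul_eq_mul,
    div_eq_inv_mul]
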